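/- Let $\Gamma$ be a finite simple connected graph, not assumed to be regular, with vertex set $X$, $n=|X|\ge 2$, and diameter $D$. Let $L=K-A$ be its Laplacian matrix ($A$ the adjacency matrix, $K$ the diagonal matrix of the vertex degrees), let $0=\theta_0<\theta_1<\cdots<\theta_d$ be the distinct eigenvalues of $L$, with multiplicities $m(\theta_0),\ldots,m(\theta_d)$, and put $\psi_i=\prod_{j\ne i}(\theta_i-\theta_j)$ for $0\le i\le d$. Let $r_0,\ldots,r_d$ be the Laplacian predistance polynomials of $\Gamma$, that is, the real polynomials with $\deg r_i=i$ that are pairwise orthogonal with respect to $\langle f,g\rangle_L=\frac1n\operatorname{tr}\bigl(f(L)g(L)\bigr)$ and normalized by $\langle r_i,r_i\rangle_L=r_i(0)$, and let $s_i=r_0+\cdots+r_i$. For $x\in X$ let $\Gamma_d(x)$ be the set of vertices at distance $d$ from $x$. Then $\Gamma$ is distance-regular (that is, for all $h,i,j$ the number of vertices at distance $i$ from $x$ and at distance $j$ from $y$ is the same for all pairs of vertices $x,y$ at distance $h$) if and only if $D=d$ and $$ \frac{|X|}{\sum_{x\in X}\frac{1}{|X|-|\Gamma_d(x)|}}=s_{d-1}(0)=|X|-r_d(0)=n\left[1-\left(\sum_{i=0}^d\frac{\psi_0^2}{m(\theta_i)\,\psi_i^2}\right)^{-1}\right].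 $$ -/

import Mathlib

open Polynomial

noncomputable section

namespace LaplacianExcess

variable {V : Type*} [Fintype V] [DecidableEq V]

/-- `sphere G i x` is the set `Γ_i(x)` of the vertices at distance `i` from `x`
(`SimpleGraph.dist` is the honest distance here, as the graphs are connected). -/
def sphere (G : SimpleGraph V) (i : ℕ) (x : V) : Finset V :=
  Finset.univ.filter fun y => G.dist x y = i

/-- A graph is distance-regular if it is connected and, for all `h`, `i`, `j`, the number
`|Γ_i(x) ∩ Γ_j(y)|` is the same for all pairs `x`, `y` of vertices at distance `h`. -/
structure IsDistanceRegular (G : SimpleGraph V) : Prop where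
  connected : G.Connected
  card_inter_eq : ∀ (i j : ℕ) (x y x' y' : V), G.dist x y = G.dist x' y' →
    (sphere G i x ∩ sphere G j y).card = (sphere G i x' ∩ sphere G j y').card

/-- The scalar product `⟨f, g⟩_L = (1/n) tr (f(L) g(L))` on polynomials,
with `L` the Laplacian matrix. -/
def lapInner (G : SimpleGraph V) [DecidableRel G.Adj] (f g : ℝ[X]) : ℝ :=
  (1 / (Fintype.card V : ℝ)) *
    Matrix.trace (aeval (G.lapMatrix ℝ) f * aeval (G.lapMatrix ℝ) g)

/-- `θ 0 < θ 1 < ⋯ < θ d` are the distinct eigenvalues of the Laplacian matrix. -/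
structure IsLapEigenvalues (G : SimpleGraph V) [DecidableRel G.Adj] (d : ℕ)
    (θ : Fin (d + 1) → ℝ) : Prop where
  strictMono : StrictMono θ
  range_eq : Set.range θ = spectrum ℝ (G.lapMatrix ℝ)

/-- The multiplicity `m(t)` of `t` as an eigenvalue of the Laplacian matrix (the algebraic one;
the matrix being symmetric, it is also the geometric one). -/
def lapMult (G : SimpleGraph V) [DecidableRel G.Adj] (t : ℝ) : ℕ :=
  (G.lapMatrix ℝ).charpoly.rootMultiplicity t

/-- `r 0, …, r d` are the Laplacian predistance polynomials: `r i` has degree `i`, they are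
pairwise orthogonal for `lapInner`, and `‖r i‖² = r i (0)`. When `d + 1` is the number of distinct
Laplacian eigenvalues of a connected graph, these conditions determine `r 0, …, r d`, and such
polynomials exist (`exists_isLapPredistance`). The values `r i` with `d < i` play no role. -/
structure IsLapPredistance (G : SimpleGraph V) [DecidableRel G.Adj] (d : ℕ)
    (r : ℕ → ℝ[X]) : Prop where
  degree_eq : ∀ i ≤ d, (r i).degree = i
  orthogonal : ∀ i ≤ d, ∀ j ≤ d, i ≠ j → lapInner G (r i) (r j) = 0
  norm_sq_eq : ∀ i ≤ d, lapInner G (r i) (r i) = (r i).eval 0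

/-- Laplacian predistance polynomials exist. -/
theorem exists_isLapPredistance [Nonempty V] (G : SimpleGraph V) [DecidableRel G.Adj] (d : ℕ)
    (θ : Fin (d + 1) → ℝ) (hθ : IsLapEigenvalues G d θ) :
    ∃ r : ℕ → ℝ[X], IsLapPredistance G d r := by
  set L := G.lapMatrix ℝ with hL
  have hn : (0 : ℝ) < Fintype.card V := by exact_mod_cast Fintype.card_pos
  have herm : ∀ f : ℝ[X], (aeval L f).IsHermitian := by
    intro f
    have h : IsSelfAdjoint L := G.isHermitian_lapMatrix (R := ℝ)
    induction f using Polynomial.induction_on' with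
    | add p q hp hq => rw [map_add]; exact hp.add hq
    | monomial k a =>
      rw [aeval_monomial, ← Algebra.smul_def]
      have := h.pow k
      exact IsSelfAdjoint.smul (IsSelfAdjoint.all a) this
  -- a polynomial of degree at most `d` which vanishes at `L` is zero
  have hzero : ∀ f : ℝ[X], f.degree < (d + 1 : ℕ) → aeval L f = 0 → f = 0 := by
    intro f hf h0
    refine Polynomial.eq_zero_of_degree_lt_of_eval_index_eq_zero Finset.univ (v := θ)
      hθ.strictMono.injective.injOn (by simpa using hf) ?_
    intro i _
    have hi : θ i ∈ spectrum ℝ L := hθ.range_eq ▸ Set.mem_range_self i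
    have := spectrum.subset_polynomial_aeval L f ⟨θ i, hi, rfl⟩
    rw [h0, spectrum.zero_eq] at this
    simpa using this
  have hpos : ∀ f : ℝ[X], f.degree < (d + 1 : ℕ) → lapInner G f f = 0 → f = 0 := by
    intro f hf h0
    apply hzero f hf
    have h1 : Matrix.trace (aeval L f * aeval L f) = 0 := by
      unfold lapInner at h0
      rcases mul_eq_zero.mp h0 with h | h
      · exact absurd h (by positivity)
      · exact h
    have h2 := herm f
    rw [← Matrix.trace_conjTranspose_mul_self_eq_zero_iff, h2.eq]
    exact h1
  let B : ℝ[X] →ₗ[ℝ] ℝ[X] →ₗ[ℝ] ℝ := LinearMap.mk₂ ℝ (lapInner G)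
    (by intros; simp [lapInner, add_mul, mul_add])
    (by intros; simp [lapInner]; ring)
    (by intros; simp [lapInner, mul_add])
    (by intros; simp [lapInner]; ring)
  have hsymm : ∀ f g, lapInner G f g = lapInner G g f := by
    intro f g
    simp [lapInner, Matrix.trace_mul_comm (aeval (G.lapMatrix ℝ) f)]
  -- orthogonal polynomials
  have hex : ∀ i : ℕ, ∃ t : ℝ[X], i ≤ d → t.degree = i ∧
      ∀ f : ℝ[X], f.degree < i → lapInner G t f = 0 := by
    intro i
    by_cases hi : i ≤ d
    swap
    · exact ⟨0, fun h => absurd h hi⟩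
    let W := degreeLT ℝ i
    have : FiniteDimensional ℝ W :=
      LinearEquiv.finiteDimensional (degreeLTEquiv ℝ i).symm
    let T : W →ₗ[ℝ] Module.Dual ℝ W := (B.compl₁₂ W.subtype W.subtype)
    have hinj : Function.Injective T := by
      rw [← LinearMap.ker_eq_bot, LinearMap.ker_eq_bot']
      intro w hw
      have h1 : lapInner G w w = 0 := by
        have := LinearMap.congr_fun hw w
        simpa [T, B] using this
      apply Subtype.ext
      refine hpos _ (lt_trans (mem_degreeLT.mp w.2) ?_) h1
      exact_mod_cast Nat.lt_succ_of_le hi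
    have hsurj : Function.Surjective T :=
      (LinearMap.injective_iff_surjective_of_finrank_eq_finrank
        (Subspace.dual_finrank_eq).symm).mp hinj
    obtain ⟨w, hw⟩ := hsurj ((B (X ^ i)).comp W.subtype)
    refine ⟨X ^ i - (w : ℝ[X]), fun _ => ⟨?_, ?_⟩⟩
    · rw [degree_sub_eq_left_of_degree_lt, degree_X_pow]
      rw [degree_X_pow]; exact mem_degreeLT.mp w.2
    · intro f hf
      have := LinearMap.congr_fun hw ⟨f, mem_degreeLT.mpr hf⟩
      have h3 : B w f = B (X ^ i) f := by simpa [T] using this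
      change B (X ^ i - (w : ℝ[X])) f = 0
      rw [map_sub, LinearMap.sub_apply, h3, sub_self]
  choose t ht using hex
  have hne : ∀ i ≤ d, t i ≠ 0 := by
    intro i hi h
    have := (ht i hi).1
    rw [h] at this
    simp at this
  have hlt : ∀ i ≤ d, (t i).degree < (d + 1 : ℕ) := by
    intro i hi
    rw [(ht i hi).1]; exact_mod_cast Nat.lt_succ_of_le hi
  have hnorm : ∀ i ≤ d, lapInner G (t i) (t i) ≠ 0 := fun i hi h =>
    hne i hi (hpos _ (hlt i hi) h)
  have heval : ∀ i ≤ d, (t i).eval 0 ≠ 0 := by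
    intro i hi h
    obtain ⟨g, hg⟩ : X ∣ t i := by
      rw [X_dvd_iff, coeff_zero_eq_eval_zero]; exact h
    have hg0 : g ≠ 0 := by rintro rfl; exact hne i hi (by simpa using hg)
    have hgd : g.degree < i := by
      rw [← (ht i hi).1, hg]
      exact degree_lt_degree_mul_X hg0 |>.trans_eq (by rw [mul_comm])
    have h1 := (ht i hi).2 g hgd
    have h2 : Matrix.trace ((aeval L g).conjTranspose * L * aeval L g) = 0 := by
      unfold lapInner at h1
      rcases mul_eq_zero.mp h1 with h | h
      · exact absurd h (by positivity)
      · rw [(herm g).eq]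
        rw [hg, map_mul, aeval_X] at h
        have hc : aeval L g * L = L * aeval L g := by
          conv_lhs => rw [← aeval_X (R := ℝ) L]
          conv_rhs => rw [← aeval_X (R := ℝ) L]
          simp only [aeval_X]
          have := congrArg (aeval L) (mul_comm g X)
          simpa using this
        rw [hc]; exact h
    have hps : ((aeval L g).conjTranspose * L * aeval L g).PosSemidef :=
      (G.posSemidef_lapMatrix ℝ).conjTranspose_mul_mul_same _
    have h3 := hps.trace_eq_zero_iff.mp h2
    rw [(herm g).eq] at h3
    have h4 : aeval L (g * X * g) = 0 := by simpa using h3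
    apply hne i hi
    refine Polynomial.eq_zero_of_degree_lt_of_eval_index_eq_zero Finset.univ (v := θ)
      hθ.strictMono.injective.injOn (by simpa using hlt i hi) ?_
    intro j _
    have hj : θ j ∈ spectrum ℝ L := hθ.range_eq ▸ Set.mem_range_self j
    have := spectrum.subset_polynomial_aeval L (g * X * g) ⟨θ j, hj, rfl⟩
    rw [h4, spectrum.zero_eq] at this
    simp at this
    rw [hg]
    simp
    tauto
  refine ⟨fun i => C ((t i).eval 0 / lapInner G (t i) (t i)) * t i, ?_, ?_, ?_⟩
  · intro i hi
    rw [degree_C_mul (div_ne_zero (heval i hi) (hnorm i hi)), (ht i hi).1]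
  · have key : ∀ i ≤ d, ∀ j < i, ∀ a b : ℝ, lapInner G (C a * t i) (C b * t j) = 0 := by
      intro i hi j hj a b
      have h1 : lapInner G (t i) (t j) = 0 := (ht i hi).2 _ (by
        rw [(ht j (by omega)).1]; exact_mod_cast hj)
      change B (C a * t i) (C b * t j) = 0
      rw [← smul_eq_C_mul, ← smul_eq_C_mul, map_smul, map_smul, LinearMap.smul_apply]
      change b • a • lapInner G (t i) (t j) = 0
      rw [h1]; simp
    intro i hi j hj hij
    rcases lt_or_gt_of_ne hij with h | h
    · rw [hsymm]; exact key j hj i h _ _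
    · exact key i hi j h _ _
  · intro i hi
    change B _ _ = _
    rw [← smul_eq_C_mul, map_smul, map_smul, LinearMap.smul_apply]
    change _ • _ • lapInner G (t i) (t i) = _
    have := hnorm i hi
    simp only [smul_eq_mul, eval_smul]
    field_simp

/-- The sum polynomial `s_i = r_0 + ⋯ + r_i`. -/
def sumPoly (r : ℕ → ℝ[X]) (i : ℕ) : ℝ[X] := ∑ j ∈ Finset.range (i + 1), r j

/-- `ψ_i = ∏_{j ≠ i} (θ_i - θ_j)`. -/
def psi {d : ℕ} (θ : Fin (d + 1) → ℝ) (i : Fin (d + 1)) : ℝ :=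
  ∏ j ∈ Finset.univ.erase i, (θ i - θ j)

end LaplacianExcess

end

open LaplacianExcess

/-!
For a polynomial `f` and the Laplacian matrix `L`, the rows of `f(L)` sum to `f(0)`, and the entry
`f(L) x y` vanishes when `deg f` is less than the distance of `x` and `y`. The polynomial
`s_d = r_0 + ⋯ + r_d` satisfies `s_d(L) = J` (`IsLapPredistance.sum_aeval_apply`), so distances are
at most `d`, and `s_{d-1}(L) = J - r_d(L)` vanishes at the pairs at distance `d`. In particular
`s_{d-1}(0) = n - r_d(0)`. The formula for `r_d(0)` comes from the orthogonality
of `r_d` to all polynomials of smaller degree, which makes `m(θ_i) r_d(θ_i)` proportional to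
`1 / ψ_i`. These two equations hold for every connected graph.

The remaining equation is the equality case of a Cauchy–Schwarz estimate for the rows of
`s_{d-1}(L)`, where `‖s_{d-1}‖² = s_{d-1}(0)`. When it holds, every row is constant off `Γ_d(x)`
(`aeval_sumPoly_pred_apply_of_eq`); symmetry and connectedness make the constant independent of the
row, and the trace makes it `1`, so `r_d(L) = A_d` (`aeval_last_eq_distMatrix_of_eq`). A backward
recurrence then gives `r_i(L) = A_i` for all `i ≤ d` (`aeval_eq_distMatrix_of_succ`), so that the
products `A_i A_j` are polynomials in `L`, hence linear combinations of distance matrices, which is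
distance-regularity.

Conversely, for a distance-regular graph the polynomials in `L` are linear combinations of
distance matrices, and a dimension count gives `D = d` and `A_d = f(L)` for some `f`
(`IsDistanceRegular.diam_eq_and_exists_aeval_eq`). Orthogonality forces `A_d = r_d(L)`, whose row
sums show `|Γ_d(x)| = r_d(0)` for all `x`.
-/

namespace LaplacianExcess

variable {V : Type*} [Fintype V] [DecidableEq V] {G : SimpleGraph V} [DecidableRel G.Adj]

/-! ### Polynomials in the Laplacian matrix -/

theorem aeval_lapMatrix_symm (f : ℝ[X]) (x y : V) :
    aeval (G.lapMatrix ℝ) f x y = aeval (G.lapMatrix ℝ) f y x := by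
  have key : (aeval (G.lapMatrix ℝ) f).IsSymm := by
    induction f using Polynomial.induction_on' with
    | add p q hp hq => rw [map_add]; exact hp.add hq
    | monomial k a =>
      rw [aeval_monomial, ← Algebra.smul_def]
      exact ((G.isSymm_lapMatrix (R := ℝ)).pow k).smul a
  exact (key.apply x y).symm

/-- The all-one vector is an eigenvector of `L` with eigenvalue `0`, so the rows of `f(L)` sum
to `f(0)`. -/
theorem sum_aeval_lapMatrix (f : ℝ[X]) (x : V) :
    ∑ y, aeval (G.lapMatrix ℝ) f x y = f.eval 0 := by
  have key : (aeval (G.lapMatrix ℝ) f).mulVec (fun _ => 1) = fun _ => f.eval 0 := by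
    induction f using Polynomial.induction_on' with
    | add p q hp hq => rw [map_add, Matrix.add_mulVec, hp, hq]; ext; simp
    | monomial k a =>
      rw [aeval_monomial, ← Algebra.smul_def, Matrix.smul_mulVec]
      cases k with
      | zero => ext; simp
      | succ k =>
        rw [pow_succ, ← Matrix.mulVec_mulVec, G.lapMatrix_mulVec_const_eq_zero]
        ext; simp
  simpa [Matrix.mulVec, dotProduct] using congrFun key x

theorem lapMatrix_apply_eq_zero {x y : V} (h : 1 < G.dist x y) : G.lapMatrix ℝ x y = 0 := by
  have h1 : x ≠ y := by rintro rfl; simp at h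
  have h2 : ¬ G.Adj x y := fun h' => by rw [SimpleGraph.dist_eq_one_iff_adj.mpr h'] at h; omega
  simp [SimpleGraph.lapMatrix, SimpleGraph.degMatrix, Matrix.diagonal_apply_ne _ h1, h2]

theorem lapMatrix_pow_apply_eq_zero (hG : G.Connected) {k : ℕ} {x y : V} (h : k < G.dist x y) :
    (G.lapMatrix ℝ ^ k) x y = 0 := by
  induction k generalizing x with
  | zero =>
    rw [pow_zero, Matrix.one_apply_ne]
    rintro rfl; simp at h
  | succ k ih =>
    rw [pow_succ', Matrix.mul_apply]
    refine Finset.sum_eq_zero fun z _ => ?_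
    rcases lt_or_ge 1 (G.dist x z) with hz | hz
    · rw [lapMatrix_apply_eq_zero hz, zero_mul]
    · have := hG.dist_triangle (u := x) (v := z) (w := y)
      rw [ih (by omega), mul_zero]

/-- A polynomial of degree `k` in the Laplacian matrix only sees distances up to `k`. -/
theorem aeval_lapMatrix_apply_eq_zero (hG : G.Connected) {f : ℝ[X]} {x y : V}
    (h : f.degree < (G.dist x y : ℕ)) : aeval (G.lapMatrix ℝ) f x y = 0 := by
  rw [aeval_eq_sum_range, Matrix.sum_apply]
  refine Finset.sum_eq_zero fun k _ => ?_
  rw [Matrix.smul_apply]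
  rcases lt_or_ge k (G.dist x y) with hk | hk
  · rw [lapMatrix_pow_apply_eq_zero hG hk, smul_zero]
  · rw [coeff_eq_zero_of_degree_lt (h.trans_le (by exact_mod_cast hk)), zero_smul]

theorem lapMatrix_mul_apply_eq_zero (hG : G.Connected) {M : Matrix V V ℝ} {x y : V} {i : ℕ}
    (hM : ∀ z, M z y ≠ 0 → i ≤ G.dist z y) (h : G.dist x y + 1 < i) :
    (G.lapMatrix ℝ * M) x y = 0 := by
  rw [Matrix.mul_apply]
  refine Finset.sum_eq_zero fun z _ => ?_
  rcases lt_or_ge 1 (G.dist x z) with hz | hz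
  · rw [lapMatrix_apply_eq_zero hz, zero_mul]
  · by_contra hne
    have h1 := hM z (right_ne_zero_of_mul hne)
    have h2 := hG.dist_triangle (u := z) (v := x) (w := y)
    rw [SimpleGraph.dist_comm (u := z) (v := x)] at h2
    omega

/-! ### The scalar product -/

theorem lapInner_comm (f g : ℝ[X]) : lapInner G f g = lapInner G g f := by
  simp [lapInner, Matrix.trace_mul_comm (aeval (G.lapMatrix ℝ) f)]

theorem lapInner_mul_left (p f g : ℝ[X]) : lapInner G (p * f) g = lapInner G f (p * g) := by
  simp only [lapInner, ← map_mul]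
  congr 3
  ring

theorem lapInner_add_right (f g h : ℝ[X]) :
    lapInner G f (g + h) = lapInner G f g + lapInner G f h := by
  simp [lapInner, mul_add]

theorem lapInner_C_mul_right (a : ℝ) (f g : ℝ[X]) :
    lapInner G f (C a * g) = a * lapInner G f g := by
  rw [← smul_eq_C_mul]
  simp [lapInner]
  ring

theorem lapInner_sum_right {ι : Type*} (s : Finset ι) (f : ℝ[X]) (g : ι → ℝ[X]) :
    lapInner G f (∑ i ∈ s, g i) = ∑ i ∈ s, lapInner G f (g i) := by
  simp [lapInner, Finset.mul_sum, Matrix.trace_sum]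

theorem lapInner_congr_left {f f' : ℝ[X]} (g : ℝ[X])
    (h : aeval (G.lapMatrix ℝ) f = aeval (G.lapMatrix ℝ) f') :
    lapInner G f g = lapInner G f' g := by
  rw [lapInner, h, lapInner]

theorem lapInner_eq_sum_sum (f g : ℝ[X]) :
    lapInner G f g = (1 / (Fintype.card V : ℝ)) *
      ∑ x, ∑ y, aeval (G.lapMatrix ℝ) f x y * aeval (G.lapMatrix ℝ) g x y := by
  simp only [lapInner, Matrix.trace, Matrix.diag_apply, Matrix.mul_apply]
  simp_rw [aeval_lapMatrix_symm g]

theorem trace_aeval_lapMatrix (f : ℝ[X]) :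
    (aeval (G.lapMatrix ℝ) f).trace =
      ∑ v, f.eval ((G.isHermitian_lapMatrix (R := ℝ)).eigenvalues v) := by
  set hA := G.isHermitian_lapMatrix (R := ℝ)
  conv_lhs => rw [hA.spectral_theorem]
  rw [aeval_algHom_apply, Unitary.conjStarAlgAut_apply, Matrix.trace_mul_comm, ← mul_assoc]
  have h1 : aeval (Matrix.diagonal (RCLike.ofReal ∘ hA.eigenvalues : V → ℝ)) f
      = Matrix.diagonal (fun v => f.eval (hA.eigenvalues v)) := by
    change aeval (Matrix.diagonalAlgHom ℝ _) f = _
    rw [aeval_algHom_apply, Matrix.diagonalAlgHom_apply]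
    congr 1
    ext v
    simp
  rw [h1]
  simp [Matrix.trace_diagonal]

theorem lapMult_eq_card (t : ℝ) : lapMult G t = (Finset.univ.filter fun v =>
    (G.isHermitian_lapMatrix (R := ℝ)).eigenvalues v = t).card := by
  rw [lapMult, ← count_roots, Matrix.IsHermitian.roots_charpoly_eq_eigenvalues
    (G.isHermitian_lapMatrix (R := ℝ)), Multiset.count_map]
  simp [Finset.card_def, eq_comm]

section Eigenvalues

variable {d : ℕ} {θ : Fin (d + 1) → ℝ}

theorem lapMult_pos (hθ : IsLapEigenvalues G d θ) (i : Fin (d + 1)) : 0 < lapMult G (θ i) := by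
  have h : θ i ∈ spectrum ℝ (G.lapMatrix ℝ) := hθ.range_eq ▸ Set.mem_range_self i
  rw [(G.isHermitian_lapMatrix (R := ℝ)).spectrum_real_eq_range_eigenvalues] at h
  obtain ⟨v, hv⟩ := h
  rw [lapMult_eq_card]
  exact Finset.card_pos.mpr ⟨v, by simpa using hv⟩

theorem lapInner_eq_sum_lapMult (hθ : IsLapEigenvalues G d θ) (f g : ℝ[X]) :
    lapInner G f g = (1 / (Fintype.card V : ℝ)) *
      ∑ i, (lapMult G (θ i) : ℝ) * ((f.eval (θ i)) * g.eval (θ i)) := by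
  rw [lapInner, ← map_mul, trace_aeval_lapMatrix]
  congr 1
  set lam := (G.isHermitian_lapMatrix (R := ℝ)).eigenvalues with hl
  have h1 : ∀ i, (lapMult G (θ i) : ℝ) * ((f.eval (θ i)) * g.eval (θ i)) =
      ∑ v, if lam v = θ i then (f * g).eval (lam v) else 0 := by
    intro i
    rw [lapMult_eq_card, ← Finset.sum_filter, Finset.sum_congr rfl
      (g := fun _ => (f * g).eval (θ i)), Finset.sum_const]
    · simp [hl]
    · intro v hv
      rw [(Finset.mem_filter.mp hv).2]
  simp_rw [h1]
  rw [Finset.sum_comm]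
  refine Finset.sum_congr rfl fun v _ => ?_
  have hv : lam v ∈ Set.range θ := by
    rw [hθ.range_eq]
    exact Matrix.IsHermitian.eigenvalues_mem_spectrum_real _ v
  obtain ⟨i, hi⟩ := hv
  rw [Finset.sum_eq_single i]
  · simp [hi]
  · intro j _ hj
    rw [if_neg]
    rw [← hi]
    exact fun h => hj (hθ.strictMono.injective h).symm
  · simp

theorem aeval_lapMatrix_eq_zero_of_lapInner_self [Nonempty V] {f : ℝ[X]}
    (h : lapInner G f f = 0) : aeval (G.lapMatrix ℝ) f = 0 := by
  have hn : (0 : ℝ) < Fintype.card V := by exact_mod_cast Fintype.card_pos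
  rw [lapInner_eq_sum_sum] at h
  have h1 := (mul_eq_zero.mp h).resolve_left (by positivity)
  have h2 := (Finset.sum_eq_zero_iff_of_nonneg
    fun x _ => Finset.sum_nonneg fun y _ => mul_self_nonneg _).mp h1
  ext x y
  have h3 := (Finset.sum_eq_zero_iff_of_nonneg fun y _ => mul_self_nonneg _).mp
    (h2 x (Finset.mem_univ _)) y (Finset.mem_univ _)
  simpa using h3

theorem aeval_lapMatrix_eq_zero_of_eval [Nonempty V] (hθ : IsLapEigenvalues G d θ) {f : ℝ[X]}
    (h : ∀ i, f.eval (θ i) = 0) : aeval (G.lapMatrix ℝ) f = 0 := by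
  apply aeval_lapMatrix_eq_zero_of_lapInner_self
  rw [lapInner_eq_sum_lapMult hθ]
  simp [h]

theorem eq_zero_of_aeval_lapMatrix_eq_zero (hθ : IsLapEigenvalues G d θ) {f : ℝ[X]}
    (hf : f.degree < (d + 1 : ℕ)) (h0 : aeval (G.lapMatrix ℝ) f = 0) : f = 0 := by
  have : Nonempty V := by
    obtain ⟨v, -⟩ := Finset.card_pos.mp ((lapMult_eq_card (G := G) (θ 0)) ▸ lapMult_pos hθ 0)
    exact ⟨v⟩
  refine Polynomial.eq_zero_of_degree_lt_of_eval_index_eq_zero Finset.univ (v := θ)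
    hθ.strictMono.injective.injOn (by simpa using hf) ?_
  intro i _
  have hi : θ i ∈ spectrum ℝ (G.lapMatrix ℝ) := hθ.range_eq ▸ Set.mem_range_self i
  have := spectrum.subset_polynomial_aeval (G.lapMatrix ℝ) f ⟨θ i, hi, rfl⟩
  rw [h0, spectrum.zero_eq] at this
  simpa using this

/-- Every polynomial in `L` is one of degree at most `d`: reduce modulo `∏ i, (X - θ i)`. -/
theorem exists_degree_lt_aeval_eq [Nonempty V] (hθ : IsLapEigenvalues G d θ) (f : ℝ[X]) :
    ∃ g : ℝ[X], g.degree < (d + 1 : ℕ) ∧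
      aeval (G.lapMatrix ℝ) g = aeval (G.lapMatrix ℝ) f := by
  set P : ℝ[X] := ∏ i, (X - C (θ i)) with hP
  have hm : P.Monic := monic_prod_of_monic _ _ fun i _ => monic_X_sub_C _
  refine ⟨f %ₘ P, ?_, ?_⟩
  · have h1 : P.degree = (d + 1 : ℕ) := by simp [hP, degree_prod]
    rw [← h1]
    exact degree_modByMonic_lt f hm
  · rw [← sub_eq_zero, ← map_sub]
    apply aeval_lapMatrix_eq_zero_of_eval hθ
    intro i
    have h2 : P.eval (θ i) = 0 := by
      rw [hP, eval_prod]
      exact Finset.prod_eq_zero (Finset.mem_univ i) (by simp)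
    have h3 := congrArg (eval (θ i)) (modByMonic_add_div f P)
    rw [eval_add, eval_mul, h2, zero_mul, add_zero] at h3
    rw [eval_sub, h3, sub_self]

theorem theta_zero_eq [Nonempty V] (hθ : IsLapEigenvalues G d θ) : θ 0 = 0 := by
  have h0 : (0 : ℝ) ∈ Set.range θ := by
    rw [hθ.range_eq, spectrum.zero_mem_iff, Matrix.isUnit_iff_isUnit_det,
      SimpleGraph.det_lapMatrix_eq_zero]
    simp
  obtain ⟨i, hi⟩ := h0
  apply le_antisymm
  · rw [← hi]; exact hθ.strictMono.monotone (Fin.zero_le i)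
  · have h1 : θ 0 ∈ spectrum ℝ (G.lapMatrix ℝ) := hθ.range_eq ▸ Set.mem_range_self 0
    rw [(G.isHermitian_lapMatrix (R := ℝ)).spectrum_real_eq_range_eigenvalues] at h1
    obtain ⟨v, hv⟩ := h1
    rw [← hv]
    exact (G.posSemidef_lapMatrix ℝ).eigenvalues_nonneg v

/-- The Laplacian analogue of the Hoffman polynomial. It is a multiple of `∏ i ≠ 0, (X - θ i)`,
and the columns of its value at `L` lie in the kernel of `L`, which is spanned by the all-one
vector. -/
theorem exists_aeval_eq_one [Nonempty V] (hG : G.Connected) (hθ : IsLapEigenvalues G d θ) :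
    ∃ H : ℝ[X], ∀ x y, aeval (G.lapMatrix ℝ) H x y = 1 := by
  have hn : (0 : ℝ) < Fintype.card V := by exact_mod_cast Fintype.card_pos
  set Q : ℝ[X] := ∏ i ∈ Finset.univ.erase 0, (X - C (θ i)) with hQ
  have hQ0 : Q.eval 0 ≠ 0 := by
    rw [hQ, eval_prod, Finset.prod_ne_zero_iff]
    intro i hi
    have := hθ.strictMono.injective.ne (Finset.ne_of_mem_erase hi)
    rw [theta_zero_eq hθ] at this
    simpa using this
  have hXQ : aeval (G.lapMatrix ℝ) (X * Q) = 0 := by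
    apply aeval_lapMatrix_eq_zero_of_eval hθ
    intro i
    rw [eval_mul, eval_X]
    by_cases hi : i = 0
    · rw [hi, theta_zero_eq hθ, zero_mul]
    · rw [hQ, eval_prod, Finset.prod_eq_zero (Finset.mem_erase.mpr ⟨hi, Finset.mem_univ i⟩)
        (by simp), mul_zero]
  have hcol : ∀ x x' y, aeval (G.lapMatrix ℝ) Q x y = aeval (G.lapMatrix ℝ) Q x' y := by
    intro x x' y
    refine (G.lapMatrix_mulVec_eq_zero_iff_forall_reachable
      (x := fun z => aeval (G.lapMatrix ℝ) Q z y)).mp ?_ x x' (hG.preconnected x x')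
    ext z
    have := congrFun (congrFun hXQ z) y
    rw [map_mul, aeval_X, Matrix.mul_apply] at this
    simpa [Matrix.mulVec, dotProduct] using this
  have hconst : ∀ x y, aeval (G.lapMatrix ℝ) Q x y = Q.eval 0 / Fintype.card V := by
    intro x y
    rw [eq_div_iff hn.ne', ← sum_aeval_lapMatrix (G := G) Q x,
      Finset.sum_congr rfl (g := fun _ => aeval (G.lapMatrix ℝ) Q x y)]
    · simp [mul_comm]
    · intro z _
      rw [aeval_lapMatrix_symm, hcol z y x, aeval_lapMatrix_symm, hcol x y y,
        aeval_lapMatrix_symm, hcol y x y]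
  refine ⟨C (Fintype.card V / Q.eval 0) * Q, fun x y => ?_⟩
  rw [map_mul, aeval_C, ← Algebra.smul_def, Matrix.smul_apply, hconst, smul_eq_mul]
  field_simp

end Eigenvalues

variable {d : ℕ} {θ : Fin (d + 1) → ℝ} {r : ℕ → ℝ[X]}

/-! ### Predistance polynomials -/

theorem lapInner_of_aeval_eq_one [Nonempty V] {H : ℝ[X]}
    (hH : ∀ x y, aeval (G.lapMatrix ℝ) H x y = 1) (f : ℝ[X]) :
    lapInner G H f = f.eval 0 := by
  simp_rw [lapInner_eq_sum_sum, hH, one_mul, sum_aeval_lapMatrix]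
  simp

theorem eval_zero_of_aeval_eq_one [Nonempty V] {H : ℝ[X]}
    (hH : ∀ x y, aeval (G.lapMatrix ℝ) H x y = 1) : H.eval 0 = Fintype.card V := by
  obtain ⟨x⟩ := ‹Nonempty V›
  simp [← sum_aeval_lapMatrix (G := G) H x, hH]

theorem IsLapPredistance.exists_eq_sum (hr : IsLapPredistance G d r) {m : ℕ} (hm : m ≤ d + 1)
    {f : ℝ[X]} (hf : f.degree < m) :
    ∃ c : ℕ → ℝ, f = ∑ k ∈ Finset.range m, C (c k) * r k := by
  induction m generalizing f with
  | zero =>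
    refine ⟨0, ?_⟩
    simpa using hf
  | succ m ih =>
    have hdeg := hr.degree_eq m (by omega)
    have hlc : (r m).coeff m ≠ 0 := coeff_ne_zero_of_eq_degree hdeg
    have hlt : (f - C (f.coeff m / (r m).coeff m) * r m).degree < m := by
      rw [degree_lt_iff_coeff_zero]
      intro k hk
      rcases hk.eq_or_lt with h | hk
      · rw [← h, coeff_sub, coeff_C_mul]; field_simp; ring
      · rw [coeff_sub, coeff_C_mul, (degree_lt_iff_coeff_zero _ _).mp hf k hk,
          coeff_eq_zero_of_degree_lt (p := r m) (n := k) (by rw [hdeg]; exact_mod_cast hk)]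
        simp
    obtain ⟨c, hc⟩ := ih (by omega) hlt
    refine ⟨fun k => if k = m then f.coeff m / (r m).coeff m else c k, ?_⟩
    rw [Finset.sum_range_succ, Finset.sum_congr rfl
      (g := fun k => C (c k) * r k), ← hc]
    · simp
    · intro k hk
      simp [(Finset.mem_range.mp hk).ne]

theorem IsLapPredistance.lapInner_eq_zero_of_degree_lt (hr : IsLapPredistance G d r) {i : ℕ}
    (hi : i ≤ d) {f : ℝ[X]} (hf : f.degree < i) : lapInner G (r i) f = 0 := by
  obtain ⟨c, hc⟩ := hr.exists_eq_sum (by omega) hf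
  rw [hc, lapInner_sum_right]
  refine Finset.sum_eq_zero fun k hk => ?_
  have := Finset.mem_range.mp hk
  rw [lapInner_C_mul_right, hr.orthogonal i hi k (by omega) (by omega), mul_zero]

theorem IsLapPredistance.eval_zero_ne_zero [Nonempty V] (hθ : IsLapEigenvalues G d θ)
    (hr : IsLapPredistance G d r) {i : ℕ} (hi : i ≤ d) : (r i).eval 0 ≠ 0 := by
  rw [← hr.norm_sq_eq i hi]
  intro h
  have hdeg := hr.degree_eq i hi
  rw [eq_zero_of_aeval_lapMatrix_eq_zero hθ (by rw [hdeg]; exact_mod_cast Nat.lt_succ_of_le hi)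
    (aeval_lapMatrix_eq_zero_of_lapInner_self h)] at hdeg
  simp at hdeg

/-- Fourier expansion in the predistance polynomials, at the level of matrices: it holds for
polynomials of arbitrary degree. -/
theorem IsLapPredistance.aeval_eq_sum [Nonempty V] (hθ : IsLapEigenvalues G d θ)
    (hr : IsLapPredistance G d r) (f : ℝ[X]) :
    aeval (G.lapMatrix ℝ) f = ∑ k ∈ Finset.range (d + 1),
      (lapInner G f (r k) / (r k).eval 0) • aeval (G.lapMatrix ℝ) (r k) := by
  obtain ⟨g, hg, hgf⟩ := exists_degree_lt_aeval_eq hθ f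
  obtain ⟨c, hc⟩ := hr.exists_eq_sum le_rfl hg
  rw [← hgf]
  conv_lhs => rw [hc]
  rw [map_sum]
  refine Finset.sum_congr rfl fun k hk => ?_
  have hk' : k ≤ d := Nat.lt_succ_iff.mp (Finset.mem_range.mp hk)
  rw [map_mul, aeval_C, ← Algebra.smul_def]
  congr 1
  rw [eq_div_iff (hr.eval_zero_ne_zero hθ hk'), ← lapInner_congr_left _ hgf, lapInner_comm, hc,
    lapInner_sum_right, Finset.sum_eq_single k]
  · rw [lapInner_C_mul_right, hr.norm_sq_eq k hk']
  · intro j hj hjk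
    rw [lapInner_C_mul_right, hr.orthogonal k hk' j
      (Nat.lt_succ_iff.mp (Finset.mem_range.mp hj)) hjk.symm, mul_zero]
  · exact fun h => absurd hk h

/-- The sum `r_0 + ⋯ + r_d` is the Hoffman polynomial, because both represent `f ↦ f(0)`. -/
theorem IsLapPredistance.sum_aeval_apply [Nonempty V] (hG : G.Connected)
    (hθ : IsLapEigenvalues G d θ) (hr : IsLapPredistance G d r) (x y : V) :
    ∑ k ∈ Finset.range (d + 1), aeval (G.lapMatrix ℝ) (r k) x y = 1 := by
  obtain ⟨H, hH⟩ := exists_aeval_eq_one hG hθ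
  rw [← hH x y, hr.aeval_eq_sum hθ H, Matrix.sum_apply]
  refine Finset.sum_congr rfl fun k hk => ?_
  rw [lapInner_of_aeval_eq_one hH, div_self (hr.eval_zero_ne_zero hθ
    (Nat.lt_succ_iff.mp (Finset.mem_range.mp hk))), one_smul]

theorem IsLapPredistance.sum_eval_zero [Nonempty V] (hG : G.Connected)
    (hθ : IsLapEigenvalues G d θ) (hr : IsLapPredistance G d r) :
    ∑ k ∈ Finset.range (d + 1), (r k).eval 0 = Fintype.card V := by
  obtain ⟨x⟩ := ‹Nonempty V›
  simp_rw [← sum_aeval_lapMatrix (G := G) _ x]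
  rw [Finset.sum_comm]
  have : Nonempty V := ⟨x⟩
  simp [hr.sum_aeval_apply hG hθ]

theorem IsLapPredistance.aeval_apply_eq_zero (hG : G.Connected) (hr : IsLapPredistance G d r)
    {i : ℕ} (hi : i ≤ d) {x y : V} (h : i < G.dist x y) :
    aeval (G.lapMatrix ℝ) (r i) x y = 0 := by
  apply aeval_lapMatrix_apply_eq_zero hG
  rw [hr.degree_eq i hi]
  exact_mod_cast h

theorem IsLapPredistance.dist_le [Nonempty V] (hG : G.Connected)
    (hθ : IsLapEigenvalues G d θ) (hr : IsLapPredistance G d r) (x y : V) : G.dist x y ≤ d := by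
  by_contra! h
  have h1 := hr.sum_aeval_apply hG hθ x y
  rw [Finset.sum_eq_zero] at h1
  · exact zero_ne_one h1
  · intro k hk
    have hk' : k ≤ d := Nat.lt_succ_iff.mp (Finset.mem_range.mp hk)
    exact hr.aeval_apply_eq_zero hG hk' (by omega)

theorem IsLapPredistance.aeval_apply_of_dist_eq [Nonempty V] (hG : G.Connected)
    (hθ : IsLapEigenvalues G d θ) (hr : IsLapPredistance G d r) {x y : V} (h : G.dist x y = d) :
    aeval (G.lapMatrix ℝ) (r d) x y = 1 := by
  rw [← hr.sum_aeval_apply hG hθ x y, Finset.sum_range_succ, Finset.sum_eq_zero, zero_add]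
  intro k hk
  have := Finset.mem_range.mp hk
  exact hr.aeval_apply_eq_zero hG (by omega) (by omega)

theorem IsLapPredistance.pos [Nontrivial V] (hG : G.Connected)
    (hθ : IsLapEigenvalues G d θ) (hr : IsLapPredistance G d r) : 0 < d := by
  obtain ⟨x, y, hxy⟩ := exists_pair_ne V
  exact (hG.pos_dist_of_ne hxy).trans_le (hr.dist_le hG hθ x y)

theorem IsLapPredistance.apply_zero_eq_one [Nonempty V] (hθ : IsLapEigenvalues G d θ)
    (hr : IsLapPredistance G d r) : r 0 = 1 := by
  have hn : (0 : ℝ) < Fintype.card V := by exact_mod_cast Fintype.card_pos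
  have h0 : r 0 = C ((r 0).eval 0) := by
    rw [← coeff_zero_eq_eval_zero]
    exact eq_C_of_degree_eq_zero (by simpa using hr.degree_eq 0 (Nat.zero_le _))
  have h1 := hr.norm_sq_eq 0 (Nat.zero_le _)
  have h2 := hr.eval_zero_ne_zero hθ (Nat.zero_le _)
  have h3 : lapInner G (r 0) (r 0) = (r 0).eval 0 * (r 0).eval 0 := by
    rw [lapInner_eq_sum_sum, h0]
    simp [aeval_C, Matrix.algebraMap_matrix_apply]
  rw [h3] at h1
  have h4 : (r 0).eval 0 = 1 := mul_left_cancel₀ h2 (by rw [h1, mul_one])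
  rw [h0, h4, C_1]

theorem sumPoly_pred_eval_zero [Nontrivial V] (hG : G.Connected)
    (hθ : IsLapEigenvalues G d θ) (hr : IsLapPredistance G d r) :
    (sumPoly r (d - 1)).eval 0 = (Fintype.card V : ℝ) - (r d).eval 0 := by
  have hd := hr.pos hG hθ
  rw [← hr.sum_eval_zero hG hθ, Finset.sum_range_succ, add_sub_cancel_right, sumPoly,
    eval_finsetSum, Nat.sub_add_cancel hd]

theorem aeval_sumPoly_pred_apply [Nontrivial V] (hG : G.Connected)
    (hθ : IsLapEigenvalues G d θ) (hr : IsLapPredistance G d r) (x y : V) :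
    aeval (G.lapMatrix ℝ) (sumPoly r (d - 1)) x y = 1 - aeval (G.lapMatrix ℝ) (r d) x y := by
  have hd := hr.pos hG hθ
  rw [← hr.sum_aeval_apply hG hθ x y, Finset.sum_range_succ, add_sub_cancel_right, sumPoly,
    map_sum, Matrix.sum_apply, Nat.sub_add_cancel hd]

theorem IsLapPredistance.lapInner_sumPoly_self (hr : IsLapPredistance G d r) {i : ℕ}
    (hi : i ≤ d) : lapInner G (sumPoly r i) (sumPoly r i) = (sumPoly r i).eval 0 := by
  conv_lhs => rw [sumPoly, lapInner_sum_right]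
  rw [sumPoly, eval_finsetSum]
  refine Finset.sum_congr rfl fun k hk => ?_
  have hk' := Finset.mem_range.mp hk
  rw [lapInner_comm, lapInner_sum_right, Finset.sum_eq_single k, hr.norm_sq_eq k (by omega)]
  · intro j hj hjk
    have hj' := Finset.mem_range.mp hj
    exact hr.orthogonal k (by omega) j (by omega) hjk.symm
  · exact fun h => absurd hk h

/-! ### The value of `r_d` at zero -/

theorem lapMult_theta_zero [Nonempty V] (hG : G.Connected) (hθ : IsLapEigenvalues G d θ) :
    lapMult G (θ 0) = 1 := by
  have hn : (0 : ℝ) < Fintype.card V := by exact_mod_cast Fintype.card_pos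
  obtain ⟨H, hH⟩ := exists_aeval_eq_one hG hθ
  have h1 := lapInner_of_aeval_eq_one hH H
  -- `H` vanishes at the nonzero eigenvalues, as `L * J = 0`.
  have hroot : ∀ i, i ≠ 0 → H.eval (θ i) = 0 := by
    intro i hi
    have hz : aeval (G.lapMatrix ℝ) (X * H) = 0 := by
      ext x y
      rw [map_mul, aeval_X, Matrix.mul_apply]
      simp_rw [hH]
      simpa [aeval_X] using sum_aeval_lapMatrix (G := G) X x
    have hmem : θ i ∈ spectrum ℝ (G.lapMatrix ℝ) := hθ.range_eq ▸ Set.mem_range_self i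
    have := spectrum.subset_polynomial_aeval (G.lapMatrix ℝ) (X * H) ⟨θ i, hmem, rfl⟩
    rw [hz, spectrum.zero_eq] at this
    have hne : θ i ≠ 0 := by
      rw [← theta_zero_eq hθ]; exact hθ.strictMono.injective.ne hi
    simpa [hne] using this
  rw [lapInner_eq_sum_lapMult hθ, Finset.sum_eq_single 0 (fun i _ hi => by simp [hroot i hi])
    (by simp), theta_zero_eq hθ, eval_zero_of_aeval_eq_one hH] at h1
  rw [theta_zero_eq hθ]
  field_simp at h1
  exact_mod_cast h1

theorem psi_ne_zero (hθ : IsLapEigenvalues G d θ) (i : Fin (d + 1)) : psi θ i ≠ 0 := by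
  rw [psi, Finset.prod_ne_zero_iff]
  intro j hj
  exact sub_ne_zero.mpr (hθ.strictMono.injective.ne (Finset.ne_of_mem_erase hj).symm)

/-- Since `r_d` is orthogonal to the polynomials of degree less than `d`, the numbers
`m(θ_i) r_d(θ_i)` are proportional to the Lagrange weights `1 / ψ_i`; the test polynomials
`∏ j ≠ i, 0, (X - θ_j)` show it. -/
theorem IsLapPredistance.lapMult_mul_eval_mul_psi [Nonempty V] (hG : G.Connected)
    (hθ : IsLapEigenvalues G d θ) (hr : IsLapPredistance G d r) (i : Fin (d + 1)) :
    (lapMult G (θ i) : ℝ) * (r d).eval (θ i) * psi θ i = (r d).eval 0 * psi θ 0 := by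
  have hn : (0 : ℝ) < Fintype.card V := by exact_mod_cast Fintype.card_pos
  by_cases hi : i = 0
  · subst hi
    rw [lapMult_theta_zero hG hθ, theta_zero_eq hθ]; simp
  set S : Finset (Fin (d + 1)) := (Finset.univ.erase i).erase 0 with hS
  set f : ℝ[X] := ∏ j ∈ S, (X - C (θ j)) with hf
  have hcard : S.card + 1 = d := by
    rw [hS, Finset.card_erase_of_mem (by simpa using Ne.symm hi),
      Finset.card_erase_of_mem (Finset.mem_univ _), Finset.card_univ, Fintype.card_fin]
    have : 0 < i.val := Nat.pos_of_ne_zero fun h => hi (Fin.ext h)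
    omega
  have hdeg : f.degree < (d : ℕ) := by
    have : f.degree = (S.card : ℕ) := by simp [hf, degree_prod]
    rw [this]
    exact_mod_cast (by omega : S.card < d)
  have h0 := hr.lapInner_eq_zero_of_degree_lt le_rfl hdeg
  rw [lapInner_eq_sum_lapMult hθ] at h0
  have h1 := (mul_eq_zero.mp h0).resolve_left (by positivity)
  rw [Finset.sum_eq_add (0 : Fin (d + 1)) i (Ne.symm hi), lapMult_theta_zero hG hθ] at h1
  · have hfi : psi θ i = (θ i - θ 0) * f.eval (θ i) := by
      rw [psi, ← Finset.mul_prod_erase _ _ (a := 0) (by simpa using Ne.symm hi), hf, eval_prod]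
      simp [hS]
    have hf0 : psi θ 0 = (θ 0 - θ i) * f.eval (θ 0) := by
      rw [psi, ← Finset.mul_prod_erase _ _ (a := i) (by simpa using hi), hf, eval_prod,
        Finset.erase_right_comm]
      simp [hS]
    rw [hfi, hf0]
    rw [theta_zero_eq hθ] at h1 ⊢
    push_cast at h1
    linear_combination (θ i) * h1
  · intro j _ hj
    rw [hf, eval_prod, Finset.prod_eq_zero (i := j) (by simp [hS, hj.1, hj.2]) (by simp)]
    simp
  · simp
  · simp

theorem card_sub_eval_zero_eq [Nonempty V] (hG : G.Connected)
    (hθ : IsLapEigenvalues G d θ) (hr : IsLapPredistance G d r) :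
    (Fintype.card V : ℝ) - (r d).eval 0 = (Fintype.card V : ℝ) *
      (1 - (∑ i : Fin (d + 1), psi θ 0 ^ 2 / ((lapMult G (θ i) : ℝ) * psi θ i ^ 2))⁻¹) := by
  have hn : (0 : ℝ) < Fintype.card V := by exact_mod_cast Fintype.card_pos
  have hne := hr.eval_zero_ne_zero hθ le_rfl
  set S := ∑ i : Fin (d + 1), psi θ 0 ^ 2 / ((lapMult G (θ i) : ℝ) * psi θ i ^ 2) with hS
  have h1 := hr.norm_sq_eq d le_rfl
  rw [lapInner_eq_sum_lapMult hθ] at h1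
  have h2 : ∑ i, (lapMult G (θ i) : ℝ) * ((r d).eval (θ i) * (r d).eval (θ i)) =
      (r d).eval 0 ^ 2 * S := by
    rw [hS, Finset.mul_sum]
    refine Finset.sum_congr rfl fun i _ => ?_
    have hm : (lapMult G (θ i) : ℝ) ≠ 0 := by exact_mod_cast (lapMult_pos hθ i).ne'
    have hp := psi_ne_zero hθ i
    have h3 := hr.lapMult_mul_eval_mul_psi hG hθ i
    field_simp
    linear_combination ((lapMult G (θ i) : ℝ) * (r d).eval (θ i) * psi θ i
      + (r d).eval 0 * psi θ 0) * h3
  rw [h2] at h1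
  have h4 : (r d).eval 0 * S = Fintype.card V := by
    field_simp at h1
    linarith
  have h5 : S ≠ 0 := right_ne_zero_of_mul (h4 ▸ hn.ne')
  rw [← h4]
  field_simp

/-! ### Distance matrices -/

/-- The distance-`i` matrix `A_i` of a graph. Unreachable pairs count as being at distance `0`, so
this is the usual notion for connected graphs only. -/
noncomputable def distMatrix {V : Type*} (G : SimpleGraph V) (i : ℕ) : Matrix V V ℝ :=
  Matrix.of fun x y => if G.dist x y = i then 1 else 0

@[simp]
theorem distMatrix_apply {V : Type*} {G : SimpleGraph V} (i : ℕ) (x y : V) :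
    distMatrix G i x y = if G.dist x y = i then 1 else 0 := rfl

theorem mem_sphere {V : Type*} [Fintype V] {G : SimpleGraph V} {i : ℕ} {x y : V} :
    y ∈ sphere G i x ↔ G.dist x y = i := by
  simp [sphere]

theorem card_sphere_inter {V : Type*} [Fintype V] [DecidableEq V] {G : SimpleGraph V}
    (i j : ℕ) (x y : V) :
    ((sphere G i x ∩ sphere G j y).card : ℝ) = (distMatrix G i * distMatrix G j) x y := by
  simp_rw [Matrix.mul_apply, distMatrix_apply, SimpleGraph.dist_comm (v := y), mul_ite, mul_one,
    mul_zero, ← ite_and, Finset.sum_boole]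
  congr 2
  ext z
  simp [mem_sphere, and_comm]

theorem sum_distMatrix {V : Type*} [Fintype V] {G : SimpleGraph V} (i : ℕ) (x : V) :
    ∑ y, distMatrix G i x y = ((sphere G i x).card : ℝ) := by
  simp [sphere]

/-- A matrix is distance-constant if its `(x, y)` entry only depends on the distance between `x`
and `y`, that is, if it is a linear combination of the distance matrices. -/
def IsDistConst {V : Type*} (G : SimpleGraph V) (M : Matrix V V ℝ) : Prop :=
  ∀ x y x' y' : V, G.dist x y = G.dist x' y' → M x y = M x' y'

theorem IsDistConst.exists_eq {V : Type*} {G : SimpleGraph V} {M : Matrix V V ℝ}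
    (hM : IsDistConst G M) :
    ∃ m : ℕ → ℝ, ∀ x y, M x y = m (G.dist x y) := by
  classical
  refine ⟨fun k => if h : ∃ p : V × V, G.dist p.1 p.2 = k then M h.choose.1 h.choose.2 else 0,
    fun x y => ?_⟩
  have h : ∃ p : V × V, G.dist p.1 p.2 = G.dist x y := ⟨(x, y), rfl⟩
  simp only [dif_pos h]
  exact hM _ _ _ _ h.choose_spec.symm

/-! ### From the equality to distance-regularity -/

theorem card_sub_card_sphere_pos [Nontrivial V] (hG : G.Connected)
    (hθ : IsLapEigenvalues G d θ) (hr : IsLapPredistance G d r) (x : V) :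
    (0 : ℝ) < (Fintype.card V : ℝ) - ((sphere G d x).card : ℝ) := by
  have hd := hr.pos hG hθ
  have : (sphere G d x).card < Fintype.card V := by
    rw [← Finset.card_univ]
    refine Finset.card_lt_card ⟨Finset.subset_univ _, fun h => ?_⟩
    have := mem_sphere.mp (h (Finset.mem_univ x))
    simp at this
    omega
  rw [sub_pos]
  exact_mod_cast this

/-- This is the equality case of the Cauchy–Schwarz inequality in each row of `s_{d-1}(L)`, which
vanishes on `Γ_d(x)`. The squared deviations from the row averages add up to zero. -/
theorem aeval_sumPoly_pred_apply_of_eq [Nontrivial V] (hG : G.Connected)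
    (hθ : IsLapEigenvalues G d θ) (hr : IsLapPredistance G d r)
    (h : (Fintype.card V : ℝ) / (∑ x : V, 1 / ((Fintype.card V : ℝ) - ((sphere G d x).card : ℝ)))
        = (sumPoly r (d - 1)).eval 0) {x y : V} (hxy : G.dist x y ≠ d) :
    aeval (G.lapMatrix ℝ) (sumPoly r (d - 1)) x y =
      (sumPoly r (d - 1)).eval 0 / ((Fintype.card V : ℝ) - ((sphere G d x).card : ℝ)) := by
  have hn : (0 : ℝ) < Fintype.card V := by exact_mod_cast Fintype.card_pos
  have hd := hr.pos hG hθ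
  have hp := card_sub_card_sphere_pos hG hθ hr
  set n : ℝ := (Fintype.card V : ℝ)
  set s := (sumPoly r (d - 1)).eval 0 with hs
  set S := aeval (G.lapMatrix ℝ) (sumPoly r (d - 1)) with hS
  set g : V → ℝ := fun x => n - ((sphere G d x).card : ℝ) with hg
  have hS0 : ∀ x y, G.dist x y = d → S x y = 0 := by
    intro x y hxy
    rw [hS, aeval_sumPoly_pred_apply hG hθ hr, hr.aeval_apply_of_dist_eq hG hθ hxy, sub_self]
  have hSS : ∑ x, ∑ y, S x y * S x y = n * s := by
    have h1 := hr.lapInner_sumPoly_self (i := d - 1) (by omega)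
    rw [lapInner_eq_sum_sum] at h1
    change 1 / n * ∑ x, ∑ y, S x y * S x y = s at h1
    rw [← h1]
    field_simp
  have hsum : s * ∑ x, 1 / g x = n := by
    have : (0 : ℝ) < ∑ x, 1 / g x := Finset.sum_pos (fun x _ => one_div_pos.mpr (hp x))
      Finset.univ_nonempty
    rw [← h]
    change n / (∑ x, 1 / g x) * _ = n
    field_simp
  have hrow : ∀ x, ∑ y, (S x y - (s / g x) * (1 - distMatrix G d x y)) ^ 2 =
      ∑ y, S x y * S x y - s * (s * (1 / g x)) := by
    intro x
    have h1 : ∀ y, (S x y - (s / g x) * (1 - distMatrix G d x y)) ^ 2 =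
        S x y * S x y - 2 * (s / g x) * S x y + (s / g x) ^ 2 * (1 - distMatrix G d x y) := by
      intro y
      rw [distMatrix_apply]
      split_ifs with hxy
      · rw [hS0 x y hxy]; ring
      · ring
    have h2 : ∑ y, (1 - distMatrix G d x y) = g x := by
      rw [Finset.sum_sub_distrib, sum_distMatrix, hg]
      simp [n]
    simp_rw [h1]
    rw [Finset.sum_add_distrib, Finset.sum_sub_distrib, ← Finset.mul_sum, ← Finset.mul_sum, h2,
      hS, sum_aeval_lapMatrix, ← hs]
    have := (hp x).ne'
    change g x ≠ 0 at this
    field_simp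
    ring
  have htot : ∑ x, ∑ y, (S x y - (s / g x) * (1 - distMatrix G d x y)) ^ 2 = 0 := by
    simp_rw [hrow]
    rw [Finset.sum_sub_distrib, hSS, ← Finset.mul_sum, ← Finset.mul_sum, hsum]
    ring
  have h3 := (Finset.sum_eq_zero_iff_of_nonneg
    fun x _ => Finset.sum_nonneg fun y _ => sq_nonneg _).mp htot x (Finset.mem_univ _)
  have h4 := (Finset.sum_eq_zero_iff_of_nonneg fun y _ => sq_nonneg _).mp h3 y
    (Finset.mem_univ _)
  have h5 := pow_eq_zero_iff (two_ne_zero) |>.mp h4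
  rw [distMatrix_apply, if_neg hxy] at h5
  linarith

/-- The row averages of `s_{d-1}(L)` agree at adjacent vertices by symmetry, hence everywhere;
the trace shows that their common value is `1`. -/
theorem aeval_last_eq_distMatrix_of_eq [Nontrivial V] (hG : G.Connected)
    (hθ : IsLapEigenvalues G d θ) (hr : IsLapPredistance G d r)
    (h : (Fintype.card V : ℝ) / (∑ x : V, 1 / ((Fintype.card V : ℝ) - ((sphere G d x).card : ℝ)))
        = (sumPoly r (d - 1)).eval 0) :
    aeval (G.lapMatrix ℝ) (r d) = distMatrix G d := by
  have hn : (0 : ℝ) < Fintype.card V := by exact_mod_cast Fintype.card_pos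
  have hd := hr.pos hG hθ
  set c : V → ℝ := fun x =>
    (sumPoly r (d - 1)).eval 0 / ((Fintype.card V : ℝ) - ((sphere G d x).card : ℝ)) with hc
  have hS : ∀ {x y : V}, G.dist x y ≠ d →
      aeval (G.lapMatrix ℝ) (sumPoly r (d - 1)) x y = c x :=
    fun hxy => aeval_sumPoly_pred_apply_of_eq hG hθ hr h hxy
  have hc1 : ∀ x, c x = 1 := by
    rcases (Nat.succ_le_of_lt hd).eq_or_lt with h1 | h1
    · intro x
      rw [← hS (x := x) (y := x) (by simp; omega), ← h1]
      simp [sumPoly, hr.apply_zero_eq_one hθ]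
    -- For `1 < d` adjacent vertices are not at distance `d`, so their common entry is available.
    · have hadj : ∀ {x y}, G.Adj x y → c x = c y := by
        intro x y hxy
        have h2 := SimpleGraph.dist_eq_one_iff_adj.mpr hxy
        have h3 := SimpleGraph.dist_eq_one_iff_adj.mpr hxy.symm
        rw [← hS (x := x) (y := y) (by omega), ← hS (x := y) (y := x) (by omega),
          aeval_lapMatrix_symm]
      have hwalk : ∀ {x y} (_ : G.Walk x y), c x = c y := by
        intro x y w
        induction w with
        | nil => rfl
        | cons hxy _ ih => exact (hadj hxy).trans ih
      intro x
      have htr : lapInner G (sumPoly r (d - 1)) 1 = 1 := by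
        rw [lapInner_comm, ← hr.apply_zero_eq_one hθ, sumPoly, lapInner_sum_right,
          Finset.sum_eq_single 0, hr.norm_sq_eq 0 (Nat.zero_le _), hr.apply_zero_eq_one hθ,
          eval_one]
        · intro k hk hk0
          have := Finset.mem_range.mp hk
          exact hr.orthogonal 0 (Nat.zero_le _) k (by omega) hk0.symm
        · simp
      have hdiag : ∀ y, aeval (G.lapMatrix ℝ) (sumPoly r (d - 1)) y y = c x := by
        intro y
        rw [hS (by simp; omega)]
        obtain ⟨w⟩ := hG.preconnected y x
        exact hwalk w
      rw [lapInner, map_one, mul_one, Matrix.trace] at htr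
      simp only [Matrix.diag_apply, hdiag, Finset.sum_const, Finset.card_univ, nsmul_eq_mul] at htr
      field_simp at htr
      exact htr
  ext x y
  rw [distMatrix_apply]
  split_ifs with hxy
  · exact hr.aeval_apply_of_dist_eq hG hθ hxy
  · have h1 := hS hxy
    rw [aeval_sumPoly_pred_apply hG hθ hr, hc1] at h1
    linarith

/-- The coefficient of `r_i` in `X * r_{i+1}` is nonzero: otherwise `r_{i+1}` would be orthogonal to
`X * r_i` and to all polynomials of degree at most `i`, hence to itself. -/
theorem lapInner_X_mul_ne_zero [Nonempty V] (hθ : IsLapEigenvalues G d θ)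
    (hr : IsLapPredistance G d r) {i : ℕ} (hi : i + 1 ≤ d) :
    lapInner G (X * r (i + 1)) (r i) ≠ 0 := by
  intro h0
  rw [lapInner_mul_left] at h0
  have hdeg := hr.degree_eq i (by omega)
  have hdeg' : (X * r i).degree = ((i + 1 : ℕ) : WithBot ℕ) := by
    rw [degree_mul, hdeg, degree_X, add_comm]; rfl
  have hlc : (X * r i).coeff (i + 1) ≠ 0 := coeff_ne_zero_of_eq_degree hdeg'
  set a := (r (i + 1)).coeff (i + 1) / (X * r i).coeff (i + 1) with ha
  have hlt : (r (i + 1) - C a * (X * r i)).degree < ((i + 1 : ℕ) : WithBot ℕ) := by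
    rw [degree_lt_iff_coeff_zero]
    intro k hk
    rcases hk.eq_or_lt with h | hk
    · rw [← h, coeff_sub, coeff_C_mul, ha]; field_simp; ring
    · rw [coeff_sub, coeff_C_mul,
        coeff_eq_zero_of_degree_lt (p := r (i + 1)) (n := k)
          (by rw [hr.degree_eq _ hi]; exact_mod_cast hk),
        coeff_eq_zero_of_degree_lt (p := X * r i) (n := k) (by rw [hdeg']; exact_mod_cast hk)]
      simp
  have h1 := hr.lapInner_eq_zero_of_degree_lt hi hlt
  have h2 := lapInner_add_right (G := G) (r (i + 1)) (r (i + 1) - C a * (X * r i))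
    (C a * (X * r i))
  rw [h1, lapInner_C_mul_right, h0, sub_add_cancel, hr.norm_sq_eq _ hi] at h2
  exact hr.eval_zero_ne_zero hθ hi (by simpa using h2)

/-- Backward three-term recurrence: `L A_{i+1}` is a combination of `r_i(L)`, with a nonzero
coefficient, and of `A_{i+1}, …, A_d`. This makes `r_i(L)` vanish at distances less than `i`. -/
theorem aeval_eq_distMatrix_of_succ [Nontrivial V] (hG : G.Connected)
    (hθ : IsLapEigenvalues G d θ) (hr : IsLapPredistance G d r) {i : ℕ} (hi : i + 1 ≤ d)
    (h : ∀ j, i < j → j ≤ d → aeval (G.lapMatrix ℝ) (r j) = distMatrix G j) :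
    aeval (G.lapMatrix ℝ) (r i) = distMatrix G i := by
  ext x y
  rw [distMatrix_apply]
  rcases lt_trichotomy (G.dist x y) i with hxy | hxy | hxy
  · rw [if_neg hxy.ne]
    have h1 := congrFun (congrFun (hr.aeval_eq_sum hθ (X * r (i + 1))) x) y
    rw [map_mul, aeval_X, h (i + 1) (by omega) hi,
      lapMatrix_mul_apply_eq_zero hG (i := i + 1), Matrix.sum_apply,
      Finset.sum_eq_single i] at h1
    · rw [Matrix.smul_apply, smul_eq_mul] at h1
      exact (mul_eq_zero.mp h1.symm).resolve_left (div_ne_zero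
        (lapInner_X_mul_ne_zero hθ hr hi) (hr.eval_zero_ne_zero hθ (by omega)))
    · intro k hk hki
      have hk' := Finset.mem_range.mp hk
      rw [Matrix.smul_apply, smul_eq_mul]
      rcases lt_or_gt_of_ne hki with hlt | hgt
      · rw [lapInner_mul_left, hr.lapInner_eq_zero_of_degree_lt hi, zero_div, zero_mul]
        rw [degree_mul, degree_X, hr.degree_eq k (by omega)]
        exact_mod_cast (by omega : 1 + k < i + 1)
      · rw [h k hgt (by omega), distMatrix_apply, if_neg (by omega), mul_zero]
    · intro hk
      exact absurd (Finset.mem_range.mpr (by omega)) hk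
    · intro z hz
      rw [distMatrix_apply] at hz
      by_contra hne
      exact hz (if_neg (by omega))
    · omega
  · rw [if_pos hxy, ← hr.sum_aeval_apply hG hθ x y, Finset.sum_eq_single i]
    · intro k hk hki
      have hk' := Finset.mem_range.mp hk
      rcases lt_or_gt_of_ne hki with hlt | hgt
      · exact hr.aeval_apply_eq_zero hG (by omega) (by omega)
      · rw [h k hgt (by omega), distMatrix_apply, if_neg (by omega)]
    · intro hk
      exact absurd (Finset.mem_range.mpr (by omega)) hk
  · rw [if_neg hxy.ne', hr.aeval_apply_eq_zero hG (by omega) hxy]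

theorem aeval_eq_distMatrix_of_last [Nontrivial V] (hG : G.Connected)
    (hθ : IsLapEigenvalues G d θ) (hr : IsLapPredistance G d r)
    (h : aeval (G.lapMatrix ℝ) (r d) = distMatrix G d) {i : ℕ}
    (hi : i ≤ d) : aeval (G.lapMatrix ℝ) (r i) = distMatrix G i := by
  induction hk : d - i using Nat.strong_induction_on generalizing i with
  | _ k ih =>
    rcases hi.eq_or_lt with rfl | hlt
    · exact h
    · exact aeval_eq_distMatrix_of_succ hG hθ hr hlt fun j hj hjd => ih (d - j) (by omega) hjd rfl

/-- If every `A_i` is a polynomial in `L`, then so is `A_i A_j`, and polynomials in `L` are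
combinations of distance matrices. -/
theorem isDistanceRegular_of_aeval_last [Nontrivial V] (hG : G.Connected)
    (hθ : IsLapEigenvalues G d θ) (hr : IsLapPredistance G d r)
    (h : aeval (G.lapMatrix ℝ) (r d) = distMatrix G d) :
    IsDistanceRegular G := by
  refine ⟨hG, fun i j x y x' y' hxy => ?_⟩
  rcases lt_or_ge d i with hi | hi
  · have : ∀ x, sphere G i x = ∅ := fun x => by
      ext z
      have := hr.dist_le hG hθ x z
      simp only [mem_sphere, Finset.notMem_empty, iff_false]
      omega
    simp [this]
  rcases lt_or_ge d j with hj | hj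
  · have : ∀ x, sphere G j x = ∅ := fun x => by
      ext z
      have := hr.dist_le hG hθ x z
      simp only [mem_sphere, Finset.notMem_empty, iff_false]
      omega
    simp [this]
  have hA : ∀ {i}, i ≤ d → aeval (G.lapMatrix ℝ) (r i) = distMatrix G i :=
    fun hi => aeval_eq_distMatrix_of_last hG hθ hr h hi
  have key : ((sphere G i x ∩ sphere G j y).card : ℝ) =
      ((sphere G i x' ∩ sphere G j y').card : ℝ) := by
    rw [card_sphere_inter, card_sphere_inter, ← hA hi, ← hA hj, ← map_mul,
      hr.aeval_eq_sum hθ, Matrix.sum_apply, Matrix.sum_apply]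
    refine Finset.sum_congr rfl fun k hk => ?_
    rw [hA (Nat.lt_succ_iff.mp (Finset.mem_range.mp hk)), Matrix.smul_apply, Matrix.smul_apply,
      distMatrix_apply, distMatrix_apply, hxy]
  exact_mod_cast key

/-! ### From distance-regularity to the equality -/

theorem IsDistanceRegular.isDistConst_mul {V : Type*} [Fintype V] [DecidableEq V]
    {G : SimpleGraph V} (h : IsDistanceRegular G) {M N : Matrix V V ℝ}
    (hM : IsDistConst G M) (hN : IsDistConst G N) : IsDistConst G (M * N) := by
  obtain ⟨m, hm⟩ := hM.exists_eq
  obtain ⟨n, hn⟩ := hN.exists_eq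
  have key : ∀ x y, (M * N) x y = ∑ p ∈ Finset.range (G.diam + 1) ×ˢ Finset.range (G.diam + 1),
      m p.1 * n p.2 * ((sphere G p.1 x ∩ sphere G p.2 y).card : ℝ) := by
    intro x y
    have hne : Nonempty V := ⟨x⟩
    have hle : ∀ u v, G.dist u v ∈ Finset.range (G.diam + 1) := fun u v =>
      Finset.mem_range.mpr (Nat.lt_succ_of_le
        (SimpleGraph.dist_le_diam (SimpleGraph.connected_iff_ediam_ne_top.mp h.connected)))
    rw [Matrix.mul_apply, ← Finset.sum_fiberwise_of_maps_to
      (g := fun z => (G.dist x z, G.dist y z)) fun z _ => Finset.mk_mem_product (hle x z) (hle y z)]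
    refine Finset.sum_congr rfl fun p _ => ?_
    rw [Finset.sum_congr rfl (g := fun _ => m p.1 * n p.2), Finset.sum_const, nsmul_eq_mul,
      mul_comm]
    · congr 3
      ext z
      simp [mem_sphere, Prod.ext_iff]
    · intro z hz
      have hz' := (Finset.mem_filter.mp hz).2
      rw [hm, hn, ← hz', SimpleGraph.dist_comm (u := z)]
  intro x y x' y' hxy
  rw [key, key]
  exact Finset.sum_congr rfl fun p _ => by rw [h.card_inter_eq p.1 p.2 x y x' y' hxy]

theorem IsDistanceRegular.isDistConst_lapMatrix (h : IsDistanceRegular G) :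
    IsDistConst G (G.lapMatrix ℝ) := by
  have hdeg : ∀ x, G.degree x = (sphere G 1 x ∩ sphere G 1 x).card := by
    intro x
    rw [Finset.inter_self, ← SimpleGraph.card_neighborFinset_eq_degree]
    congr 1
    ext z
    simp [mem_sphere]
  intro x y x' y' hxy
  by_cases h0 : x = y
  · subst h0
    have h1 : x' = y' := by
      rw [SimpleGraph.dist_self] at hxy
      exact h.connected.dist_eq_zero_iff.mp hxy.symm
    subst h1
    simp only [SimpleGraph.lapMatrix, SimpleGraph.degMatrix, Matrix.sub_apply,
      Matrix.diagonal_apply_eq, SimpleGraph.adjMatrix_apply, SimpleGraph.irrefl, if_false]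
    rw [hdeg, hdeg, h.card_inter_eq 1 1 x x x' x' hxy]
  · have h1 : x' ≠ y' := by
      rintro rfl
      rw [SimpleGraph.dist_self] at hxy
      exact h0 (h.connected.dist_eq_zero_iff.mp hxy)
    simp only [SimpleGraph.lapMatrix, SimpleGraph.degMatrix, Matrix.sub_apply,
      Matrix.diagonal_apply_ne _ h0, Matrix.diagonal_apply_ne _ h1, SimpleGraph.adjMatrix_apply]
    simp_rw [← SimpleGraph.dist_eq_one_iff_adj, hxy]

theorem IsDistanceRegular.isDistConst_aeval (h : IsDistanceRegular G) (f : ℝ[X]) :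
    IsDistConst G (aeval (G.lapMatrix ℝ) f) := by
  have hC : ∀ a : ℝ, IsDistConst G (algebraMap ℝ (Matrix V V ℝ) a) := by
    intro a x y x' y' hxy
    have : x = y ↔ x' = y' := by
      rw [← h.connected.dist_eq_zero_iff, hxy, h.connected.dist_eq_zero_iff]
    simp [Matrix.algebraMap_matrix_apply, this]
  induction f using Polynomial.induction_on with
  | C a => simpa using hC a
  | add p q hp hq =>
    intro x y x' y' hxy
    rw [map_add, Matrix.add_apply, Matrix.add_apply, hp x y x' y' hxy, hq x y x' y' hxy]
  | monomial k a ih =>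
    rw [pow_succ, ← mul_assoc, map_mul, aeval_X]
    exact h.isDistConst_mul ih h.isDistConst_lapMatrix

/-- The space of polynomials of degree at most `d` in `L` has dimension `d + 1` and consists of
distance-constant matrices. As distances are at most `d`, evaluating such matrices at one pair of
vertices for each distance is injective, hence bijective, so `A_d` is nonzero and is reached. -/
theorem IsDistanceRegular.diam_eq_and_exists_aeval_eq [Nonempty V] (h : IsDistanceRegular G)
    (hθ : IsLapEigenvalues G d θ) (hr : IsLapPredistance G d r) :
    G.diam = d ∧ ∃ f : ℝ[X], aeval (G.lapMatrix ℝ) f = distMatrix G d := by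
  have hG := h.connected
  have hle := hr.dist_le hG hθ
  -- The pair chosen for a distance that does not occur is arbitrary.
  have hrep : ∀ k : ℕ, ∃ p : V × V,
      (∃ q : V × V, G.dist q.1 q.2 = k) → G.dist p.1 p.2 = k := by
    intro k
    by_cases hk : ∃ q : V × V, G.dist q.1 q.2 = k
    · exact ⟨hk.choose, fun _ => hk.choose_spec⟩
    · exact ⟨Classical.arbitrary _, fun h => absurd h hk⟩
  choose p hp using hrep
  have hval : ∀ (f : ℝ[X]) (x y : V), aeval (G.lapMatrix ℝ) f x y =
      aeval (G.lapMatrix ℝ) f (p (G.dist x y)).1 (p (G.dist x y)).2 := fun f x y =>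
    h.isDistConst_aeval f _ _ _ _ (hp _ ⟨(x, y), rfl⟩).symm
  let T : degreeLT ℝ (d + 1) →ₗ[ℝ] (Fin (d + 1) → ℝ) :=
    { toFun := fun f k => aeval (G.lapMatrix ℝ) (f : ℝ[X]) (p k).1 (p k).2
      map_add' := fun f g => by ext k; simp
      map_smul' := fun a f => by ext k; simp }
  have hinj : Function.Injective T := by
    rw [← LinearMap.ker_eq_bot, LinearMap.ker_eq_bot']
    intro f hf
    apply Subtype.ext
    refine eq_zero_of_aeval_lapMatrix_eq_zero hθ (mem_degreeLT.mp f.2) ?_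
    ext x y
    rw [hval]
    exact congrFun hf ⟨G.dist x y, Nat.lt_succ_of_le (hle x y)⟩
  have hdim : Module.finrank ℝ (degreeLT ℝ (d + 1)) = Module.finrank ℝ (Fin (d + 1) → ℝ) :=
    (degreeLTEquiv ℝ (d + 1)).finrank_eq
  have : FiniteDimensional ℝ (degreeLT ℝ (d + 1)) :=
    LinearEquiv.finiteDimensional (degreeLTEquiv ℝ (d + 1)).symm
  obtain ⟨f, hf⟩ := (LinearMap.injective_iff_surjective_of_finrank_eq_finrank hdim).mp hinj
    (Pi.single (Fin.last d) 1)
  have hfd : aeval (G.lapMatrix ℝ) (f : ℝ[X]) = distMatrix G d := by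
    ext x y
    have h1 := congrFun hf ⟨G.dist x y, Nat.lt_succ_of_le (hle x y)⟩
    rw [hval]
    refine h1.trans ?_
    simp [Pi.single_apply, Fin.ext_iff]
  refine ⟨le_antisymm ?_ ?_, f, hfd⟩
  · obtain ⟨u, v, huv⟩ := G.exists_dist_eq_diam
    rw [← huv]
    exact hle u v
  · have h1 := congrFun hf (Fin.last d)
    rw [Pi.single_eq_same] at h1
    change aeval (G.lapMatrix ℝ) (f : ℝ[X]) (p d).1 (p d).2 = 1 at h1
    rw [hfd, distMatrix_apply] at h1
    have h2 : G.dist (p d).1 (p d).2 = d := by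
      by_contra hne
      rw [if_neg hne] at h1
      exact zero_ne_one h1
    conv_lhs => rw [← h2]
    exact SimpleGraph.dist_le_diam (SimpleGraph.connected_iff_ediam_ne_top.mp hG)

/-- The matrix `A_d` is trace-orthogonal to all `r_k(L)` with `k < d`, so it is a multiple of
`r_d(L)`; both have entries `1` at distance `d`. -/
theorem IsDistanceRegular.aeval_last_eq_distMatrix [Nonempty V] (h : IsDistanceRegular G)
    (hθ : IsLapEigenvalues G d θ) (hr : IsLapPredistance G d r) :
    aeval (G.lapMatrix ℝ) (r d) = distMatrix G d := by
  have hG := h.connected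
  obtain ⟨hD, f, hf⟩ := h.diam_eq_and_exists_aeval_eq hθ hr
  have h1 := hr.aeval_eq_sum hθ f
  rw [Finset.sum_range_succ, Finset.sum_eq_zero, zero_add, hf] at h1
  · obtain ⟨u, v, huv⟩ := G.exists_dist_eq_diam
    have huv := huv.trans hD
    have h2 := congrFun (congrFun h1 u) v
    rw [Matrix.smul_apply, hr.aeval_apply_of_dist_eq hG hθ huv, distMatrix_apply, if_pos huv,
      smul_eq_mul, mul_one] at h2
    rw [← h2, one_smul] at h1
    exact h1.symm
  · intro k hk
    have hk' := Finset.mem_range.mp hk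
    have h0 : lapInner G f (r k) = 0 := by
      rw [lapInner_eq_sum_sum, hf]
      refine mul_eq_zero_of_right _ (Finset.sum_eq_zero fun x _ => Finset.sum_eq_zero fun y _ => ?_)
      rw [distMatrix_apply]
      split_ifs with hxy
      · rw [hr.aeval_apply_eq_zero hG hk'.le (by omega), mul_zero]
      · rw [zero_mul]
    rw [h0, zero_div, zero_smul]

theorem IsDistanceRegular.card_div_sum_eq [Nontrivial V] (h : IsDistanceRegular G)
    (hθ : IsLapEigenvalues G d θ) (hr : IsLapPredistance G d r) :
    (Fintype.card V : ℝ) / (∑ x : V, 1 / ((Fintype.card V : ℝ) - ((sphere G d x).card : ℝ)))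
      = (sumPoly r (d - 1)).eval 0 := by
  have hn : (0 : ℝ) < Fintype.card V := by exact_mod_cast Fintype.card_pos
  have hk : ∀ x, ((sphere G d x).card : ℝ) = (r d).eval 0 := fun x => by
    rw [← sum_distMatrix, ← h.aeval_last_eq_distMatrix hθ hr, sum_aeval_lapMatrix]
  rw [sumPoly_pred_eval_zero h.connected hθ hr]
  simp_rw [hk]
  rw [Finset.sum_const, Finset.card_univ, nsmul_eq_mul, mul_one_div, div_div_cancel₀ hn.ne']

end LaplacianExcess
theorem corollary3p2 {V : Type*} [Fintype V] [DecidableEq V] [Nontrivial V]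
    (G : SimpleGraph V) [DecidableRel G.Adj] (hG : G.Connected)
    (d : ℕ) (θ : Fin (d + 1) → ℝ) (hθ : IsLapEigenvalues G d θ)
    (r : ℕ → ℝ[X]) (hr : IsLapPredistance G d r) :
    IsDistanceRegular G ↔
      G.diam = d ∧
      (Fintype.card V : ℝ) /
          (∑ x : V, 1 / ((Fintype.card V : ℝ) - ((sphere G d x).card : ℝ)))
        = (sumPoly r (d - 1)).eval 0 ∧
      (sumPoly r (d - 1)).eval 0 = (Fintype.card V : ℝ) - (r d).eval 0 ∧
      (Fintype.card V : ℝ) - (r d).eval 0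
        = (Fintype.card V : ℝ) *
            (1 - (∑ i : Fin (d + 1),
              psi θ 0 ^ 2 / ((lapMult G (θ i) : ℝ) * psi θ i ^ 2))⁻¹) := by
  constructor
  · intro h
    exact ⟨(h.diam_eq_and_exists_aeval_eq hθ hr).1, h.card_div_sum_eq hθ hr,
      sumPoly_pred_eval_zero hG hθ hr, card_sub_eval_zero_eq hG hθ hr⟩
  · rintro ⟨-, h, -⟩
    exact isDistanceRegular_of_aeval_last hG hθ hr (aeval_last_eq_distMatrix_of_eq hG hθ hr h)
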